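/- **Maxwell-like form of Einstein's equations.** Let $(M,g)$ be a smooth four-dimensional Lorentzian manifold of signature $(1,3)$, $D$ its Levi-Civita connection, and $\{\mathbf e_a\}_{a=0}^3$ a smooth orthonormal frame on an open set $U\subseteq M$, $g(\mathbf e_a,\mathbf e_b)=\eta_{ab}$, $(\eta_{ab})=\mathrm{diag}(1,-1,-1,-1)$, with reciprocal frame $\mathbf e^a=\eta^{ab}\mathbf e_b$ (repeated indices are summed). Vectors and multivectors are regarded as sections of the Clifford bundle $\mathcal{C}\ell(TM)$, whose product (juxtaposition) is generated by $vv=g(v,v)$; $\lrcorner$ is the left contraction. The connection acts on Clifford fields by $D_vA=\partial_vA+\tfrac12[\omega_v,A]$, where $\partial_v$ differentiates the components of $A$ in the basis of products $\mathbf e_{i_1}\cdots\mathbf e_{i_k}$ $(i_1<\dots<i_k)$ and $\omega_v=\tfrac12\,g(\mathbf e^b,D_v\mathbf e^c)\,\mathbf e_b\mathbf e_c$. Put $$R_{abcd}=g\big(\mathbf e_a,\,(D_{\mathbf e_c}D_{\mathbf e_d}-D_{\mathbf e_d}D_{\mathbf e_c}-D_{[\mathbf e_c,\mathbf e_d]})\mathbf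 e_b\big),\qquad R_{ab}=\eta^{cd}R_{adbc},\qquad R=\eta^{ab}R_{ab},$$ let $\mathbf R_{ab}=\tfrac12R_{cdab}\,\mathbf e^c\mathbf e^d$ be the curvature bivectors and $R_a=R_{ab}\mathbf e^b$ the Ricci vectors. Let $T$ be a field of bilinear forms on the tangent spaces, with $T_{ab}=T(\mathbf e_a,\mathbf e_b)$, $T_a=T_{ab}\mathbf e^b$, $T^a=\eta^{ac}T_c$, and define $$\mathcal F_{ab}=(-\mathbf e^c\lrcorner\mathbf R_{ac})\,\mathbf e_b-\mathbf e_b\,(-\mathbf e^c\lrcorner\mathbf R_{ac})-\tfrac12R\,(\mathbf e_a\mathbf e_b-\mathbf e_b\mathbf e_a),\qquad \mathcal F^a_{\;b}=\eta^{ac}\mathcal F_{cb},$$ $$\mathcal J_b=D_{\mathbf e_a}\big(T^a\mathbf e_b-\mathbf e_bT^a\big).$$ Suppose that Einstein's equations $R_{ab}-\tfrac12\eta_{ab}R=T_{ab}$ hold on $U$. Then, on $U$: 1. the $\mathcal F_{ab}$ are smooth bivector fields, and $-\mathbf e^c\lrcorner\mathbf R_{ac}=R_a$; 2. $D_{\mathbf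 e_a}\mathcal F^a_{\;b}=\mathcal J_b$ for every $b$; 3. $\mathcal F_{ab}=0$ for all $a,b$ at every point where $T=0$ (vacuum). The curvature bivectors, however, need not vanish in vacuum: on $\mathbb R^4$ there is a smooth Lorentzian metric of signature $(1,3)$ with a global smooth orthonormal frame that satisfies Einstein's equations with $T=0$ (so that all $\mathcal F_{ab}=0$) and for which $\mathbf R_{ab}\neq0$ for some $a,b$ at some point. -/

import Mathlib

open scoped Manifold ContDiff
open Bundle

noncomputable section

namespace MaxwellEinstein

/-- The model space of a four dimensional manifold. -/
abbrev E4 : Type := EuclideanSpace ℝ (Fin 4)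

-- A vector space is a manifold through the atlas with the identity as its single chart.
attribute [instance 2000] chartedSpaceSelf

/-- The Minkowski matrix `diag(1, -1, -1, -1)`; it equals its own inverse, so that the same matrix
serves as `η_{ab}` and as `η^{ab}`. -/
def eta (a b : Fin 4) : ℝ :=
  if a = b then (if a = 0 then 1 else -1) else 0

/-- A smooth Lorentzian metric of signature `(1, 3)` on a smooth four dimensional manifold. -/
structure LorentzMetric (M : Type*) [TopologicalSpace M] [ChartedSpace E4 M]
    [IsManifold (𝓡 4) ∞ M] where
  form (x : M) : TangentSpace (𝓡 4) x →L[ℝ] TangentSpace (𝓡 4) x →L[ℝ] ℝ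
  symm (x : M) (v w : TangentSpace (𝓡 4) x) : form x v w = form x w v
  signature (x : M) : ∃ b : Module.Basis (Fin 4) ℝ (TangentSpace (𝓡 4) x),
    ∀ i j, form x (b i) (b j) = eta i j
  smooth : ContMDiff (𝓡 4) ((𝓡 4).prod 𝓘(ℝ, E4 →L[ℝ] E4 →L[ℝ] ℝ)) ∞
    (fun x : M ↦ TotalSpace.mk' (E4 →L[ℝ] E4 →L[ℝ] ℝ)
      (E := fun x : M ↦ TangentSpace (𝓡 4) x →L[ℝ] TangentSpace (𝓡 4) x →L[ℝ] ℝ) x (form x))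

section

variable {M : Type*} [TopologicalSpace M] [ChartedSpace E4 M] [IsManifold (𝓡 4) ∞ M]

/-- Linear connections on the tangent bundle; `D Y x (X x)` is `(D_X Y)(x)`. -/
abbrev LinConnection (M : Type*) [TopologicalSpace M] [ChartedSpace E4 M]
    [IsManifold (𝓡 4) ∞ M] : Type _ :=
  CovariantDerivative (𝓡 4) E4 (TangentSpace (𝓡 4) : M → Type _)

/-- `D` is the Levi-Civita connection of `g`: it is torsion free and `D g = 0`. -/
structure IsLeviCivita (g : LorentzMetric M) (D : LinConnection M) : Prop where
  torsion_eq_zero : D.torsion = 0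
  metric {X Y : Π x : M, TangentSpace (𝓡 4) x} {x : M}
    (hX : MDifferentiableAt (𝓡 4) ((𝓡 4).prod 𝓘(ℝ, E4)) (fun y ↦ TotalSpace.mk' E4 y (X y)) x)
    (hY : MDifferentiableAt (𝓡 4) ((𝓡 4).prod 𝓘(ℝ, E4)) (fun y ↦ TotalSpace.mk' E4 y (Y y)) x)
    (v : TangentSpace (𝓡 4) x) :
    mvfderiv (𝓡 4) (fun y ↦ g.form y (X y) (Y y)) x v =
      g.form x (D X x v) (Y x) + g.form x (X x) (D Y x v)

/-- A smooth orthonormal frame `e_0, e_1, e_2, e_3` on the set `U`. -/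
structure IsOrthonormalFrameOn (g : LorentzMetric M)
    (e : Fin 4 → Π x : M, TangentSpace (𝓡 4) x) (U : Set M) : Prop where
  isLocalFrameOn : IsLocalFrameOn (𝓡 4) E4 ∞ e U
  orthonormal {x : M} (hx : x ∈ U) (a b : Fin 4) : g.form x (e a x) (e b x) = eta a b

/-! ### The Clifford bundle -/

/-- The quadratic form `v ↦ g(v, v)` on the tangent space at `x`. -/
def LorentzMetric.quad (g : LorentzMetric M) (x : M) : QuadraticForm ℝ (TangentSpace (𝓡 4) x) :=
  (g.form x).toBilinForm.toQuadraticMap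

/-- The fibre at `x` of the Clifford bundle of the tangent bundle, with `v v = g(v, v)`. -/
abbrev Cl (g : LorentzMetric M) (x : M) : Type := CliffordAlgebra (g.quad x)

/-- A tangent vector as an element of the Clifford algebra. -/
abbrev vec (g : LorentzMetric M) {x : M} (v : TangentSpace (𝓡 4) x) : Cl g x :=
  CliffordAlgebra.ι (g.quad x) v

/-- The left contraction `v ⌟ A` of a multivector by a vector. -/
def contr (g : LorentzMetric M) {x : M} (v : TangentSpace (𝓡 4) x) (A : Cl g x) : Cl g x :=
  CliffordAlgebra.contractLeft ((g.form x v).toLinearMap : Module.Dual ℝ (TangentSpace (𝓡 4) x)) A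

/-- `A` is a bivector, that is, `A` lies in the image of `⋀² T_x M` under the canonical linear
isomorphism of the exterior algebra with the Clifford algebra (which sends `u ∧ v` to
`(u v - v u) / 2`). -/
def IsBivector (g : LorentzMetric M) {x : M} (A : Cl g x) : Prop :=
  CliffordAlgebra.equivExterior (g.quad x) A ∈ ⋀[ℝ]^2 (TangentSpace (𝓡 4) x)

/-- The reciprocal frame `e^a = η^{ab} e_b`. -/
def recip (e : Fin 4 → Π x : M, TangentSpace (𝓡 4) x) (a : Fin 4) (x : M) :
    TangentSpace (𝓡 4) x :=
  ∑ b, eta a b • e b x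

section Frame

variable {g : LorentzMetric M} {e : Fin 4 → Π x : M, TangentSpace (𝓡 4) x} {U : Set M}

/-- The basis of the Clifford algebra at `x ∈ U` given by the multivectors
`e_{i₁} ∧ ⋯ ∧ e_{iₖ} = e_{i₁} ⋯ e_{iₖ}` with `i₁ < ⋯ < iₖ`, indexed by the sets
`{i₁, …, iₖ}`. -/
def IsOrthonormalFrameOn.clBasis (he : IsOrthonormalFrameOn g e U) {x : M} (hx : x ∈ U) :
    Module.Basis (Finset (Fin 4)) ℝ (Cl g x) :=
  (he.isLocalFrameOn.toBasisAt hx).ExteriorAlgebra.map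
    (CliffordAlgebra.equivExterior (g.quad x)).symm

open scoped Classical in
/-- The components of a Clifford field in the basis `clBasis` (zero outside `U`). -/
def IsOrthonormalFrameOn.clCoeff (he : IsOrthonormalFrameOn g e U) (A : Π x : M, Cl g x)
    (I : Finset (Fin 4)) (x : M) : ℝ :=
  if hx : x ∈ U then (he.clBasis hx).repr (A x) I else 0

/-- The Clifford field `A` is smooth on `U`. -/
def IsOrthonormalFrameOn.IsSmooth (he : IsOrthonormalFrameOn g e U) (A : Π x : M, Cl g x) : Prop :=
  ∀ I, ContMDiffOn (𝓡 4) 𝓘(ℝ) ∞ (he.clCoeff A I) U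

end Frame

/-- The connection bivector `ω_v = ½ ω_v^{bc} e_b e_c`, where `ω_v^{bc} = g(e^b, D_v e^c)`, that is,
`D_{e_a} e_b = ω_{ab}^c e_c`. -/
def omega (g : LorentzMetric M) (D : LinConnection M) (e : Fin 4 → Π x : M, TangentSpace (𝓡 4) x)
    {x : M} (v : TangentSpace (𝓡 4) x) : Cl g x :=
  (1 / 2 : ℝ) • ∑ b, ∑ c, g.form x (recip e b x) (D (recip e c) x v) •
    (vec g (e b x) * vec g (e c x))

/-- The covariant derivative `D_v A = ∂_v A + ½ [ω_v, A]` of a Clifford field at `x ∈ U`, where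
`∂_v` differentiates the components of `A` in the basis built from the frame. -/
def IsOrthonormalFrameOn.clDeriv {g : LorentzMetric M} {e : Fin 4 → Π x : M, TangentSpace (𝓡 4) x}
    {U : Set M} (he : IsOrthonormalFrameOn g e U) (D : LinConnection M) (A : Π x : M, Cl g x)
    {x : M} (hx : x ∈ U) (v : TangentSpace (𝓡 4) x) : Cl g x :=
  ∑ I, mvfderiv (𝓡 4) (he.clCoeff A I) x v • he.clBasis hx I +
    (1 / 2 : ℝ) • (omega g D e v * A x - A x * omega g D e v)

/-! ### Curvature and matter -/

/-- The curvature `D_X D_Y Z - D_Y D_X Z - D_{[X, Y]} Z`. -/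
def curvature (D : LinConnection M) (X Y Z : Π x : M, TangentSpace (𝓡 4) x) (x : M) :
    TangentSpace (𝓡 4) x :=
  D (fun y ↦ D Z y (Y y)) x (X x) - D (fun y ↦ D Z y (X y)) x (Y x)
    - D Z x (VectorField.mlieBracket (𝓡 4) X Y x)

/-- The components `R_{abcd} = g(e_a, R(e_c, e_d) e_b)` of the Riemann tensor. -/
def riemann (g : LorentzMetric M) (D : LinConnection M)
    (e : Fin 4 → Π x : M, TangentSpace (𝓡 4) x) (a b c d : Fin 4) (x : M) : ℝ :=
  g.form x (e a x) (curvature D (e c) (e d) (e b) x)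

/-- The components `R_{ab} = R_a{}^c{}_{bc}` of the Ricci tensor. -/
def ricci (g : LorentzMetric M) (D : LinConnection M)
    (e : Fin 4 → Π x : M, TangentSpace (𝓡 4) x) (a b : Fin 4) (x : M) : ℝ :=
  ∑ c, ∑ d, eta c d * riemann g D e a d b c x

/-- The scalar curvature `R = η^{ab} R_{ab}`. -/
def scalar (g : LorentzMetric M) (D : LinConnection M)
    (e : Fin 4 → Π x : M, TangentSpace (𝓡 4) x) (x : M) : ℝ :=
  ∑ a, ∑ b, eta a b * ricci g D e a b x

/-- The curvature bivectors `𝐑_{ab} = ½ R_{cdab} e^c e^d`. -/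
def curvBivector (g : LorentzMetric M) (D : LinConnection M)
    (e : Fin 4 → Π x : M, TangentSpace (𝓡 4) x) (a b : Fin 4) (x : M) : Cl g x :=
  (1 / 2 : ℝ) • ∑ c, ∑ d, riemann g D e c d a b x •
    (vec g (recip e c x) * vec g (recip e d x))

/-- The Ricci vectors `R_a = R_{ab} e^b`. -/
def ricciVec (g : LorentzMetric M) (D : LinConnection M)
    (e : Fin 4 → Π x : M, TangentSpace (𝓡 4) x) (a : Fin 4) (x : M) : Cl g x :=
  ∑ b, ricci g D e a b x • vec g (recip e b x)

/-- A field of bilinear forms on the tangent spaces, such as the energy-momentum tensor. -/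
abbrev TensorField02 (M : Type*) [TopologicalSpace M] [ChartedSpace E4 M] : Type _ :=
  Π x : M, LinearMap.BilinForm ℝ (TangentSpace (𝓡 4) x)

/-- Einstein's equations `R_{ab} - ½ η_{ab} R = T_{ab}` on `U`, with `T_{ab} = T(e_a, e_b)`. -/
def EinsteinEqOn (g : LorentzMetric M) (D : LinConnection M)
    (e : Fin 4 → Π x : M, TangentSpace (𝓡 4) x) (T : TensorField02 M) (U : Set M) : Prop :=
  ∀ x ∈ U, ∀ a b,
    ricci g D e a b x - 1 / 2 * eta a b * scalar g D e x = T x (e a x) (e b x)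

/-- The energy-momentum vectors `T^a = η^{ac} T_c`, where `T_a = T_{ab} e^b`. -/
def emVecUp (g : LorentzMetric M) (e : Fin 4 → Π x : M, TangentSpace (𝓡 4) x)
    (T : TensorField02 M) (a : Fin 4) (x : M) : Cl g x :=
  ∑ c, eta a c • ∑ b, T x (e c x) (e b x) • vec g (recip e b x)

/-- The sum `-e^c ⌟ 𝐑_{ac}`. -/
def contrCurv (g : LorentzMetric M) (D : LinConnection M)
    (e : Fin 4 → Π x : M, TangentSpace (𝓡 4) x) (a : Fin 4) (x : M) : Cl g x :=
  ∑ c, -contr g (recip e c x) (curvBivector g D e a c x)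

/-- `𝓕_{ab} = (-e^c ⌟ 𝐑_{ac}) e_b - e_b (-e^c ⌟ 𝐑_{ac}) - ½ R (e_a e_b - e_b e_a)`. -/
def calF (g : LorentzMetric M) (D : LinConnection M)
    (e : Fin 4 → Π x : M, TangentSpace (𝓡 4) x) (a b : Fin 4) (x : M) : Cl g x :=
  contrCurv g D e a x * vec g (e b x) - vec g (e b x) * contrCurv g D e a x
    - (1 / 2 * scalar g D e x) •
      (vec g (e a x) * vec g (e b x) - vec g (e b x) * vec g (e a x))

/-- `𝓕^a_b = η^{ac} 𝓕_{cb}`. -/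
def calFUp (g : LorentzMetric M) (D : LinConnection M)
    (e : Fin 4 → Π x : M, TangentSpace (𝓡 4) x) (a b : Fin 4) (x : M) : Cl g x :=
  ∑ c, eta a c • calF g D e c b x

/-- `𝓙_b = D_{e_a} (T^a e_b - e_b T^a)` at the point `x ∈ U`. -/
def calJ {g : LorentzMetric M} {e : Fin 4 → Π x : M, TangentSpace (𝓡 4) x} {U : Set M}
    (he : IsOrthonormalFrameOn g e U) (D : LinConnection M) (T : TensorField02 M) (b : Fin 4)
    {x : M} (hx : x ∈ U) : Cl g x :=
  ∑ a, he.clDeriv D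
    (fun y ↦ emVecUp g e T a y * vec g (e b y) - vec g (e b y) * emVecUp g e T a y) hx (e a x)

end

end MaxwellEinstein

end

/-!
The statement rests on one identity. By definition `𝓕_{ab}` is the commutator of the vector
`-e^c ⌟ 𝐑_{ac} - ½ R e_a` with `e_b`. If the contraction `-e^c ⌟ 𝐑_{ac}` is the Ricci vector `R_a`
(`contrCurv_eq_ricciVec`), then the first factor is the vector form of the left side of Einstein's
equations, which therefore say that `𝓕_{ab} = T_a e_b - e_b T_a` on all of `U`
(`calF_eq_of_einsteinEqOn`). The Maxwell-like equation is the divergence of this identity, an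
equality of fields on an open set, and the vanishing of `𝓕_{ab}` where `T = 0` is immediate.

*The contraction.* Contracting `½ R_{fdac} e^f e^d` with `-e^c` gives `η^{cf} R_{dfac} e^d`, which
is `R_{da} e^d` rather than `R_{ad} e^d`, so the Ricci tensor has to be symmetric (`ricci_symm`). As
usual this follows from the pair symmetry, hence from antisymmetry of the curvature in its first two
indices (`riemann_antisymm_left`, from `D g = 0`) and from the first Bianchi identity
(`curvature_cyclic`, from vanishing torsion and the Jacobi identity).

*Smoothness.* The connection is not assumed to be smooth. In an orthonormal frame the Koszul formula
(`christoffel_eq`) expresses its coefficients through the Lie brackets of the frame, which makes the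
coefficients and with them the Riemann, Ricci and scalar curvatures smooth on `U`. The field
`𝓕_{ab}` is a combination with such coefficients of commutators `e_c e_b - e_b e_c = 2 e_c ∧ e_b`,
and these are bivectors with constant components.

*A curved vacuum.* The metric `η + H k ⊗ k` on `ℝ⁴`, with the null covector `k = dx⁰ - dx³` and
`H = (x¹)² - (x²)²`, is a plane gravitational wave. It has the global orthonormal frame
`e_a = ∂_a - ½ H k_a k^♯`. The curvature has constant components in this frame, quadratic in
`k` and linear in the Hessian of `H` (`riemann_frame`). The Ricci tensor vanishes because `k` is
null and `H` is harmonic in the transverse coordinates, while `R_{0101} = -1`.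
-/

noncomputable section

namespace MaxwellEinstein

/-! ### The connection in an orthonormal frame -/

section FrameCalculus

variable {M : Type*} [TopologicalSpace M] [ChartedSpace E4 M] [IsManifold (𝓡 4) ∞ M]
  {g : LorentzMetric M} {D : LinConnection M}
  {e : Fin 4 → Π x : M, TangentSpace (𝓡 4) x} {U : Set M}

lemma eta_of_ne {a b : Fin 4} (h : a ≠ b) : eta a b = 0 := by simp [eta, h]

lemma eta_mul_eta_self (a : Fin 4) : eta a a * eta a a = 1 := by
  fin_cases a <;> simp [eta]

lemma sum_eta_smul {V : Type*} [AddCommGroup V] [Module ℝ V] (a : Fin 4) (f : Fin 4 → V) :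
    ∑ b, eta a b • f b = eta a a • f a :=
  Finset.sum_eq_single a (fun b _ hb ↦ by simp [eta_of_ne hb.symm]) (by simp)

lemma sum_eta_mul (a : Fin 4) (f : Fin 4 → ℝ) : ∑ b, eta a b * f b = eta a a * f a :=
  sum_eta_smul a f

/-- The vector field `X` is smooth at `x`. -/
abbrev SmoothFieldAt (X : Π x : M, TangentSpace (𝓡 4) x) (x : M) : Prop :=
  ContMDiffAt (𝓡 4) ((𝓡 4).prod 𝓘(ℝ, E4)) ∞ (fun y ↦ TotalSpace.mk' E4 y (X y)) x

/-- The vector field `X` is differentiable at `x`. -/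
abbrev DiffFieldAt (X : Π x : M, TangentSpace (𝓡 4) x) (x : M) : Prop :=
  MDifferentiableAt (𝓡 4) ((𝓡 4).prod 𝓘(ℝ, E4)) (fun y ↦ TotalSpace.mk' E4 y (X y)) x

/-- The components `g(e_a, D_{e_c} e_b)` of the connection in a frame. -/
def christoffel (g : LorentzMetric M) (D : LinConnection M)
    (e : Fin 4 → Π x : M, TangentSpace (𝓡 4) x) (a b c : Fin 4) (x : M) : ℝ :=
  g.form x (e a x) (D (e b) x (e c x))

/-- The components `g(e_a, [e_c, e_d])` of the Lie brackets of the frame fields. -/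
def bracketCoeff (g : LorentzMetric M) (e : Fin 4 → Π x : M, TangentSpace (𝓡 4) x)
    (a c d : Fin 4) (x : M) : ℝ :=
  g.form x (e a x) (VectorField.mlieBracket (𝓡 4) (e c) (e d) x)

namespace IsOrthonormalFrameOn

lemma contMDiffAt (he : IsOrthonormalFrameOn g e U) (hU : IsOpen U) {x : M} (hx : x ∈ U)
    (a : Fin 4) : SmoothFieldAt (e a) x :=
  he.isLocalFrameOn.contMDiffAt hU hx a

lemma mdifferentiableAt (he : IsOrthonormalFrameOn g e U) (hU : IsOpen U) {x : M} (hx : x ∈ U)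
    (a : Fin 4) : DiffFieldAt (e a) x :=
  (he.contMDiffAt hU hx a).mdifferentiableAt (by simp)

lemma sum_form_smul (he : IsOrthonormalFrameOn g e U) {x : M} (hx : x ∈ U)
    (v : TangentSpace (𝓡 4) x) :
    ∑ a, (eta a a * g.form x (e a x) v) • e a x = v := by
  have hv := (he.isLocalFrameOn.toBasisAt hx).sum_repr v
  simp only [IsLocalFrameOn.toBasisAt_coe] at hv
  have key (a : Fin 4) : eta a a * g.form x (e a x) v =
      (he.isLocalFrameOn.toBasisAt hx).repr v a := by
    conv_lhs => rw [← hv]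
    simp only [map_sum, map_smul, he.orthonormal hx, smul_eq_mul]
    simp_rw [mul_comm _ (eta a _)]
    rw [sum_eta_mul, ← mul_assoc, eta_mul_eta_self, one_mul]
  simp_rw [key]
  exact hv

end IsOrthonormalFrameOn

lemma LorentzMetric.contMDiffAt_form (g : LorentzMetric M) {X Y : Π x : M, TangentSpace (𝓡 4) x}
    {x : M} (hX : SmoothFieldAt X x) (hY : SmoothFieldAt Y x) :
    ContMDiffAt (𝓡 4) 𝓘(ℝ) ∞ (fun y ↦ g.form y (X y) (Y y)) x := by
  have h := ContMDiffAt.clm_bundle_apply₂ (F₁ := E4) (F₂ := E4) (F₃ := ℝ)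
    (E₁ := fun x : M ↦ TangentSpace (𝓡 4) x) (E₂ := fun x : M ↦ TangentSpace (𝓡 4) x)
    (E₃ := Bundle.Trivial M ℝ) (b := fun y : M ↦ y) (g.smooth x) hX hY
  exact (contMDiffAt_totalSpace.1 h).2

lemma contMDiffAt_mvfderiv_apply {f : M → ℝ} {X : Π x : M, TangentSpace (𝓡 4) x} {x : M}
    (hf : ContMDiffAt (𝓡 4) 𝓘(ℝ) ∞ f x) (hX : SmoothFieldAt X x) :
    ContMDiffAt (𝓡 4) 𝓘(ℝ) ∞ (fun y ↦ mvfderiv (𝓡 4) f y (X y)) x := by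
  have h := ContMDiffAt.clm_apply_of_inCoordinates (𝕜 := ℝ) (F₁ := E4) (F₂ := ℝ)
    (E₁ := fun x : M ↦ TangentSpace (𝓡 4) x) (E₂ := fun x : ℝ ↦ TangentSpace 𝓘(ℝ) x)
    (b₁ := id) (b₂ := f) (ϕ := fun y ↦ mfderiv (𝓡 4) 𝓘(ℝ) f y) (v := X)
    (hf.mfderiv_const (m := ∞) (by simp)) hX hf
  have h2 := (contMDiffAt_totalSpace.1 h).2
  simp at h2
  exact h2

omit [IsManifold (𝓡 4) ∞ M] in
lemma mvfderiv_congr_of_eqOn {f f' : M → ℝ} (hU : IsOpen U) {x : M} (hx : x ∈ U)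
    (h : ∀ y ∈ U, f y = f' y) : mvfderiv (𝓡 4) f x = mvfderiv (𝓡 4) f' x := by
  have h' : f =ᶠ[nhds x] f' := Filter.eventuallyEq_of_mem (hU.mem_nhds hx) h
  ext v
  simp only [mvfderiv, ContinuousLinearMap.comp_apply, h'.mfderiv_eq]
  rfl

namespace IsOrthonormalFrameOn

lemma form_covDeriv_add (he : IsOrthonormalFrameOn g e U) (hD : IsLeviCivita g D)
    (hU : IsOpen U) {x : M} (hx : x ∈ U) (a b : Fin 4) (v : TangentSpace (𝓡 4) x) :
    g.form x (e a x) (D (e b) x v) + g.form x (e b x) (D (e a) x v) = 0 := by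
  have h := hD.metric (he.mdifferentiableAt hU hx a) (he.mdifferentiableAt hU hx b) v
  rw [mvfderiv_congr_of_eqOn hU hx fun y hy ↦ he.orthonormal hy a b, mvfderiv_const,
    g.symm x (D (e a) x v)] at h
  rw [add_comm]
  exact h.symm

lemma christoffel_antisymm (he : IsOrthonormalFrameOn g e U) (hD : IsLeviCivita g D)
    (hU : IsOpen U) {x : M} (hx : x ∈ U) (a b c : Fin 4) :
    christoffel g D e a b c x = -christoffel g D e b a c x :=
  eq_neg_of_add_eq_zero_left (he.form_covDeriv_add hD hU hx a b (e c x))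

lemma christoffel_sub (he : IsOrthonormalFrameOn g e U) (hD : IsLeviCivita g D)
    (hU : IsOpen U) {x : M} (hx : x ∈ U) (a b c : Fin 4) :
    christoffel g D e a b c x - christoffel g D e a c b x = bracketCoeff g e a c b x := by
  have h := (D.torsion_eq_zero_iff.1 hD.torsion_eq_zero) (he.mdifferentiableAt hU hx c)
    (he.mdifferentiableAt hU hx b)
  rw [christoffel, christoffel, bracketCoeff, ← h, map_sub]

/-- The Koszul formula in an orthonormal frame. It shows that the connection is smooth on the
domain of the frame, although smoothness is not part of the definition of a connection. -/
lemma christoffel_eq (he : IsOrthonormalFrameOn g e U) (hD : IsLeviCivita g D)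
    (hU : IsOpen U) {x : M} (hx : x ∈ U) (a b c : Fin 4) :
    christoffel g D e a b c x = 1 / 2 * (bracketCoeff g e a c b x + bracketCoeff g e b a c x
      - bracketCoeff g e c b a x) := by
  have h1 := he.christoffel_sub hD hU hx a b c
  have h2 := he.christoffel_sub hD hU hx b c a
  have h3 := he.christoffel_sub hD hU hx c a b
  have k1 := he.christoffel_antisymm hD hU hx b a c
  have k2 := he.christoffel_antisymm hD hU hx c a b
  have k3 := he.christoffel_antisymm hD hU hx c b a
  linarith

lemma contMDiffAt_mlieBracket (he : IsOrthonormalFrameOn g e U) (hU : IsOpen U) {x : M}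
    (hx : x ∈ U) (c d : Fin 4) :
    SmoothFieldAt (VectorField.mlieBracket (𝓡 4) (e c) (e d)) x := by
  have : IsManifold (𝓡 4) (minSmoothness ℝ 2) M :=
    IsManifold.of_le (n := ∞) (by simpa using ENat.LEInfty.out)
  have : IsManifold (𝓡 4) (((⊤ : ℕ∞) : WithTop ℕ∞) + 1) M :=
    IsManifold.of_le (n := ∞) (by simp)
  exact ContMDiffAt.mlieBracket_vectorField (m := ⊤) (n := ⊤) (he.contMDiffAt hU hx c)
    (he.contMDiffAt hU hx d) (by simp)

lemma contMDiffAt_bracketCoeff (he : IsOrthonormalFrameOn g e U) (hU : IsOpen U) {x : M}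
    (hx : x ∈ U) (a c d : Fin 4) :
    ContMDiffAt (𝓡 4) 𝓘(ℝ) ∞ (bracketCoeff g e a c d) x :=
  g.contMDiffAt_form (he.contMDiffAt hU hx a) (he.contMDiffAt_mlieBracket hU hx c d)

lemma contMDiffAt_christoffel (he : IsOrthonormalFrameOn g e U) (hD : IsLeviCivita g D)
    (hU : IsOpen U) {x : M} (hx : x ∈ U) (a b c : Fin 4) :
    ContMDiffAt (𝓡 4) 𝓘(ℝ) ∞ (christoffel g D e a b c) x := by
  refine ContMDiffAt.congr_of_eventuallyEq (contMDiffAt_const.mul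
    (((he.contMDiffAt_bracketCoeff hU hx a c b).add (he.contMDiffAt_bracketCoeff hU hx b a c)).sub
      (he.contMDiffAt_bracketCoeff hU hx c b a)))
    (Filter.eventuallyEq_of_mem (hU.mem_nhds hx) fun y hy ↦ he.christoffel_eq hD hU hy a b c)

lemma contMDiffAt_covDeriv (he : IsOrthonormalFrameOn g e U) (hD : IsLeviCivita g D)
    (hU : IsOpen U) {x : M} (hx : x ∈ U) (b c : Fin 4) :
    SmoothFieldAt (fun y ↦ D (e b) y (e c y)) x := by
  have h : SmoothFieldAt (fun y ↦ ∑ a, (eta a a * christoffel g D e a b c y) • e a y) x :=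
    .sum_section fun a _ ↦ (contMDiffAt_const.mul
      (he.contMDiffAt_christoffel hD hU hx a b c)).smul_section (he.contMDiffAt hU hx a)
  refine h.congr_of_eventuallyEq (Filter.eventuallyEq_of_mem (hU.mem_nhds hx) fun y hy ↦ ?_)
  simp only [christoffel, he.sum_form_smul hy]

/-! ### Smoothness and symmetries of the curvature -/

/-- The components of the curvature in terms of the connection coefficients, without expanding
the terms that are quadratic in the connection. -/
lemma riemann_eq (he : IsOrthonormalFrameOn g e U) (hD : IsLeviCivita g D)
    (hU : IsOpen U) {x : M} (hx : x ∈ U) (a b c d : Fin 4) :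
    riemann g D e a b c d x =
      mvfderiv (𝓡 4) (christoffel g D e a b d) x (e c x)
        - mvfderiv (𝓡 4) (christoffel g D e a b c) x (e d x)
        - g.form x (D (e a) x (e c x)) (D (e b) x (e d x))
        + g.form x (D (e a) x (e d x)) (D (e b) x (e c x))
        - g.form x (e a x) (D (e b) x (VectorField.mlieBracket (𝓡 4) (e c) (e d) x)) := by
  have h (c d : Fin 4) := hD.metric (he.mdifferentiableAt hU hx a)
    ((he.contMDiffAt_covDeriv hD hU hx b d).mdifferentiableAt (by simp)) (e c x)
  have h1 := h c d
  have h2 := h d c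
  simp only [riemann, curvature, map_sub]
  change mvfderiv (𝓡 4) (christoffel g D e a b d) x (e c x) = _ at h1
  change mvfderiv (𝓡 4) (christoffel g D e a b c) x (e d x) = _ at h2
  linarith

lemma contMDiffAt_riemann (he : IsOrthonormalFrameOn g e U) (hD : IsLeviCivita g D)
    (hU : IsOpen U) {x : M} (hx : x ∈ U) (a b c d : Fin 4) :
    ContMDiffAt (𝓡 4) 𝓘(ℝ) ∞ (riemann g D e a b c d) x := by
  have hΓ (a b c : Fin 4) := he.contMDiffAt_christoffel hD hU hx a b c
  have hW (b c : Fin 4) := he.contMDiffAt_covDeriv hD hU hx b c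
  have hlast : ContMDiffAt (𝓡 4) 𝓘(ℝ) ∞
      (fun y ↦ ∑ f, eta f f * bracketCoeff g e f c d y * christoffel g D e a b f y) x :=
    ContMDiffAt.sum fun f _ ↦ (contMDiffAt_const.mul
      (he.contMDiffAt_bracketCoeff hU hx f c d)).mul (hΓ a b f)
  refine ContMDiffAt.congr_of_eventuallyEq
    (((((contMDiffAt_mvfderiv_apply (hΓ a b d) (he.contMDiffAt hU hx c)).sub
      (contMDiffAt_mvfderiv_apply (hΓ a b c) (he.contMDiffAt hU hx d))).sub
      (g.contMDiffAt_form (hW a c) (hW b d))).add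
      (g.contMDiffAt_form (hW a d) (hW b c))).sub hlast)
    (Filter.eventuallyEq_of_mem (hU.mem_nhds hx) fun y hy ↦ ?_)
  rw [he.riemann_eq hD hU hy]
  simp only [Pi.add_apply]
  congr 1
  conv_lhs => rw [← he.sum_form_smul hy (VectorField.mlieBracket (𝓡 4) (e c) (e d) y)]
  simp only [map_sum, map_smul, smul_eq_mul]
  rfl

lemma contMDiffAt_ricci (he : IsOrthonormalFrameOn g e U) (hD : IsLeviCivita g D)
    (hU : IsOpen U) {x : M} (hx : x ∈ U) (a b : Fin 4) :
    ContMDiffAt (𝓡 4) 𝓘(ℝ) ∞ (ricci g D e a b) x :=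
  ContMDiffAt.sum fun c _ ↦ ContMDiffAt.sum fun d _ ↦
    contMDiffAt_const.mul (he.contMDiffAt_riemann hD hU hx a d b c)

lemma contMDiffAt_scalar (he : IsOrthonormalFrameOn g e U) (hD : IsLeviCivita g D)
    (hU : IsOpen U) {x : M} (hx : x ∈ U) :
    ContMDiffAt (𝓡 4) 𝓘(ℝ) ∞ (scalar g D e) x :=
  ContMDiffAt.sum fun a _ ↦ ContMDiffAt.sum fun b _ ↦
    contMDiffAt_const.mul (he.contMDiffAt_ricci hD hU hx a b)

lemma riemann_antisymm_left (he : IsOrthonormalFrameOn g e U) (hD : IsLeviCivita g D)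
    (hU : IsOpen U) {x : M} (hx : x ∈ U) (a b c d : Fin 4) :
    riemann g D e a b c d x = -riemann g D e b a c d x := by
  have h (c : Fin 4) (v : TangentSpace (𝓡 4) x) :
      mvfderiv (𝓡 4) (christoffel g D e a b c) x v =
        -mvfderiv (𝓡 4) (christoffel g D e b a c) x v := by
    rw [mvfderiv_congr_of_eqOn hU hx fun y hy ↦ he.christoffel_antisymm hD hU hy a b c,
      mvfderiv_fun_neg]
    rfl
  have h2 := he.form_covDeriv_add hD hU hx a b (VectorField.mlieBracket (𝓡 4) (e c) (e d) x)
  rw [he.riemann_eq hD hU hx, he.riemann_eq hD hU hx, h c, h d,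
    g.symm x (D (e b) x (e c x)), g.symm x (D (e b) x (e d x))]
  linarith

lemma riemann_antisymm_right (a b c d : Fin 4) (x : M) :
    riemann g D e a b c d x = -riemann g D e a b d c x := by
  simp only [riemann, curvature, VectorField.mlieBracket_swap_apply (V := e d) (W := e c), map_sub,
    map_neg]
  ring

/-- The first Bianchi identity: for a torsion free connection the cyclic sum of the curvature is
the cyclic sum of the double brackets of the three fields, which vanishes. -/
lemma curvature_cyclic (he : IsOrthonormalFrameOn g e U) (hD : IsLeviCivita g D)
    (hU : IsOpen U) {x : M} (hx : x ∈ U) (b c d : Fin 4) :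
    curvature D (e c) (e d) (e b) x + curvature D (e d) (e b) (e c) x
      + curvature D (e b) (e c) (e d) x = 0 := by
  have : IsManifold (𝓡 4) (minSmoothness ℝ 3) M :=
    IsManifold.of_le (n := ∞) (by simpa using ENat.LEInfty.out)
  have hT {X Y : Π x : M, TangentSpace (𝓡 4) x} {y : M} (hX : DiffFieldAt X y)
      (hY : DiffFieldAt Y y) :
      D Y y (X y) - D X y (Y y) = VectorField.mlieBracket (𝓡 4) X Y y :=
    D.torsion_eq_zero_iff.1 hD.torsion_eq_zero hX hY
  -- `D_{e_a} [e_b, e_c] - D_{[e_b, e_c]} e_a = [e_a, [e_b, e_c]]`, with the inner bracket expanded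
  have key (a b c : Fin 4) : D (fun y ↦ D (e c) y (e b y)) x (e a x)
      - D (fun y ↦ D (e b) y (e c y)) x (e a x)
      - D (e a) x (VectorField.mlieBracket (𝓡 4) (e b) (e c) x) =
      VectorField.mlieBracket (𝓡 4) (e a) (VectorField.mlieBracket (𝓡 4) (e b) (e c)) x := by
    have hbr := (he.contMDiffAt_mlieBracket hU hx b c).mdifferentiableAt (by simp)
    have h1 : DiffFieldAt (fun y ↦ D (e c) y (e b y)) x :=
      (he.contMDiffAt_covDeriv hD hU hx c b).mdifferentiableAt (by simp)
    have h2 : DiffFieldAt (fun y ↦ D (e b) y (e c y)) x :=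
      (he.contMDiffAt_covDeriv hD hU hx b c).mdifferentiableAt (by simp)
    rw [← hT (he.mdifferentiableAt hU hx a) hbr]
    congr 1
    have hadd := D.isCovariantDerivativeOnUniv.add hbr h2
    have hsum : D (VectorField.mlieBracket (𝓡 4) (e b) (e c) + fun y ↦ D (e b) y (e c y)) x =
        D (fun y ↦ D (e c) y (e b y)) x := by
      refine D.isCovariantDerivativeOnUniv.congr_of_eventuallyEq
        (mdifferentiableAt_add_section hbr h2) h1 Filter.univ_mem
        (Filter.eventually_of_mem (hU.mem_nhds hx) fun y hy ↦ ?_)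
      simp only [Pi.add_apply]
      rw [← hT (he.mdifferentiableAt hU hy b) (he.mdifferentiableAt hU hy c), sub_add_cancel]
    rw [hsum] at hadd
    rw [hadd]
    simp
  have hs (a : Fin 4) : ContMDiffAt (𝓡 4) ((𝓡 4).prod 𝓘(ℝ, E4)) (minSmoothness ℝ 2)
      (fun y ↦ TotalSpace.mk' E4 y (e a y)) x :=
    (he.contMDiffAt hU hx a).of_le (by simpa using ENat.LEInfty.out)
  have hJ := VectorField.leibniz_identity_mlieBracket_apply (hs b) (hs c) (hs d)
  have k1 := key b c d
  have k2 := key c d b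
  have k3 := key d b c
  rw [VectorField.mlieBracket_swap_apply (V := VectorField.mlieBracket (𝓡 4) (e b) (e c)),
    VectorField.mlieBracket_swap (V := e b) (W := e d),
    show -VectorField.mlieBracket (𝓡 4) (e d) (e b) =
      (-1 : ℝ) • VectorField.mlieBracket (𝓡 4) (e d) (e b) by simp,
    VectorField.mlieBracket_const_smul_right
      ((he.contMDiffAt_mlieBracket hU hx d b).mdifferentiableAt (by simp)),
    ← k1, ← k2, ← k3] at hJ
  simp only [curvature]
  rw [← sub_eq_zero] at hJ
  rw [← hJ]
  module

lemma riemann_cyclic (he : IsOrthonormalFrameOn g e U) (hD : IsLeviCivita g D)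
    (hU : IsOpen U) {x : M} (hx : x ∈ U) (a b c d : Fin 4) :
    riemann g D e a b c d x + riemann g D e a c d b x + riemann g D e a d b c x = 0 := by
  simp only [riemann, ← map_add]
  rw [he.curvature_cyclic hD hU hx, map_zero]

lemma riemann_pair_symm (he : IsOrthonormalFrameOn g e U) (hD : IsLeviCivita g D)
    (hU : IsOpen U) {x : M} (hx : x ∈ U) (a b c d : Fin 4) :
    riemann g D e a b c d x = riemann g D e c d a b x := by
  have hl := he.riemann_antisymm_left hD hU hx
  have hr (a b c d : Fin 4) := riemann_antisymm_right (g := g) (D := D) (e := e) a b c d x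
  have hc := he.riemann_cyclic hD hU hx
  linarith [hc a b c d, hc b c d a, hc c d a b, hc d a b c, hl a b c d, hl a c d b, hl a d b c,
    hl b c d a, hl b d a c, hl c d a b, hr a b c d, hr a c b d, hr b c a d, hr c d a b,
    hr b d a c, hr a d b c, hr c a b d, hr d a b c, hr b d c a, hr c a d b, hr d b a c,
    hr d b c a, hl c a b d, hl d a b c, hl d b c a, hl c b d a, hr c b d a, hr c b a d,
    hr b a d c, hr d c a b, hl d c a b, hr d a c b]

lemma ricci_symm (he : IsOrthonormalFrameOn g e U) (hD : IsLeviCivita g D)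
    (hU : IsOpen U) {x : M} (hx : x ∈ U) (a b : Fin 4) :
    ricci g D e a b x = ricci g D e b a x := by
  simp only [ricci, sum_eta_mul]
  exact Finset.sum_congr rfl fun c _ ↦ by rw [he.riemann_pair_symm hD hU hx]

end IsOrthonormalFrameOn

end FrameCalculus

/-! ### Clifford fields and Einstein's equations -/

section CliffordFields

variable {M : Type*} [TopologicalSpace M] [ChartedSpace E4 M] [IsManifold (𝓡 4) ∞ M]
  {g : LorentzMetric M} {D : LinConnection M}
  {e : Fin 4 → Π x : M, TangentSpace (𝓡 4) x} {U : Set M}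

omit [IsManifold (𝓡 4) ∞ M] in
lemma recip_eq (e : Fin 4 → Π x : M, TangentSpace (𝓡 4) x) (a : Fin 4) (x : M) :
    recip e a x = eta a a • e a x :=
  sum_eta_smul a fun b ↦ e b x

lemma equivExterior_commutator (g : LorentzMetric M) {x : M} (u v : TangentSpace (𝓡 4) x) :
    CliffordAlgebra.equivExterior (g.quad x) (vec g u * vec g v - vec g v * vec g u) =
      (2 : ℝ) • (ExteriorAlgebra.ι ℝ u * ExteriorAlgebra.ι ℝ v) := by
  have h (u v : TangentSpace (𝓡 4) x) : CliffordAlgebra.equivExterior (g.quad x)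
      (vec g u * vec g v) = ExteriorAlgebra.ι ℝ u * ExteriorAlgebra.ι ℝ v -
        algebraMap ℝ _ (QuadraticMap.associated (R := ℝ) (-g.quad x) u v) :=
    CliffordAlgebra.changeForm_ι_mul_ι CliffordAlgebra.changeForm.associated_neg_proof u v
  have hs : QuadraticMap.associated (R := ℝ) (-g.quad x) u v =
      QuadraticMap.associated (R := ℝ) (-g.quad x) v u :=
    QuadraticMap.associated_isSymm ℝ _ u v
  have hc := ExteriorAlgebra.ι_add_mul_swap (R := ℝ) u v
  rw [map_sub, h, h, hs, eq_neg_of_add_eq_zero_right hc]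
  module

lemma isBivector_commutator (g : LorentzMetric M) {x : M} (u v : TangentSpace (𝓡 4) x) :
    IsBivector g (vec g u * vec g v - vec g v * vec g u) := by
  rw [IsBivector, equivExterior_commutator]
  refine Submodule.smul_mem _ _ ?_
  rw [ExteriorAlgebra.exteriorPower, pow_two]
  exact Submodule.mul_mem_mul (LinearMap.mem_range_self _ u) (LinearMap.mem_range_self _ v)

/-- The components of `e_i ∧ e_j` with respect to the basis `clBasis` do not depend on the point:
they are read off from the multiplication table of the basis of the exterior algebra. -/
lemma IsOrthonormalFrameOn.exists_clCoeff_commutator (he : IsOrthonormalFrameOn g e U)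
    (i j : Fin 4) (I : Finset (Fin 4)) :
    ∃ k : ℝ, ∀ x (hx : x ∈ U), (he.clBasis hx).repr
      (vec g (e i x) * vec g (e j x) - vec g (e j x) * vec g (e i x)) I = k := by
  classical
  let s (i : Fin 4) : Set.powersetCard (Fin 4) 1 := ⟨{i}, by simp⟩
  have hι {x : M} (hx : x ∈ U) (i : Fin 4) : ExteriorAlgebra.ι ℝ (e i x) =
      (he.isLocalFrameOn.toBasisAt hx).ExteriorAlgebra (s i) := by
    rw [ExteriorAlgebra.basis_apply_powersetCard]
    obtain ⟨k, hk⟩ := (Set.powersetCard.mem_range_ofFinEmbEquiv_symm_iff_mem (s i) i).2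
      (Finset.mem_singleton_self i)
    rw [Subsingleton.elim k 0] at hk
    simp [ExteriorAlgebra.ιMulti_family, ExteriorAlgebra.ιMulti_apply, hk]
  have hrepr {x : M} (hx : x ∈ U) : (he.clBasis hx).repr
      (vec g (e i x) * vec g (e j x) - vec g (e j x) * vec g (e i x)) I =
      2 * (he.isLocalFrameOn.toBasisAt hx).ExteriorAlgebra.repr
        ((he.isLocalFrameOn.toBasisAt hx).ExteriorAlgebra (s i) *
          (he.isLocalFrameOn.toBasisAt hx).ExteriorAlgebra (s j)) I := by
    rw [clBasis, Module.Basis.map_repr, LinearEquiv.trans_apply, LinearEquiv.symm_symm,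
      equivExterior_commutator, hι hx, hι hx, map_smul]
    rfl
  by_cases hd : Disjoint (s i).val (s j).val
  · refine ⟨2 * ((Set.powersetCard.permOfDisjoint hd).sign : ℤ) *
      Finsupp.single (Set.powersetCard.disjUnion hd).val (1 : ℝ) I, fun x hx ↦ ?_⟩
    rw [hrepr hx, ExteriorAlgebra.basis_mul_of_disjoint _ _ _ hd, Units.smul_def, map_zsmul,
      Module.Basis.repr_self]
    simp [Finsupp.single_apply]
  · refine ⟨0, fun x hx ↦ ?_⟩
    rw [hrepr hx, ExteriorAlgebra.basis_mul_of_not_disjoint _ _ _ hd]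
    simp

lemma contr_vec_mul_vec (g : LorentzMetric M) {x : M} (u v w : TangentSpace (𝓡 4) x) :
    contr g u (vec g v * vec g w) = g.form x u v • vec g w - g.form x u w • vec g v := by
  rw [contr, CliffordAlgebra.contractLeft_ι_mul, CliffordAlgebra.contractLeft_ι, ← Algebra.commutes,
    ← Algebra.smul_def]
  rfl

namespace IsOrthonormalFrameOn

lemma form_recip (he : IsOrthonormalFrameOn g e U) {x : M} (hx : x ∈ U) (a b : Fin 4) :
    g.form x (recip e a x) (recip e b x) = eta a b := by
  rw [recip_eq, recip_eq]
  simp only [map_smul, smul_apply, he.orthonormal hx, smul_eq_mul]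
  fin_cases a <;> fin_cases b <;> simp [eta]

lemma contr_curvBivector (he : IsOrthonormalFrameOn g e U) (hD : IsLeviCivita g D)
    (hU : IsOpen U) {x : M} (hx : x ∈ U) (f a b : Fin 4) :
    contr g (recip e f x) (curvBivector g D e a b x) =
      ∑ d, (eta f f * riemann g D e f d a b x) • vec g (recip e d x) := by
  have hlin (A : Cl g x) : contr g (recip e f x) A = CliffordAlgebra.contractLeft
      ((g.form x (recip e f x)).toLinearMap : Module.Dual ℝ (TangentSpace (𝓡 4) x)) A := rfl
  rw [hlin, curvBivector]
  simp only [map_smul, map_sum]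
  simp only [← hlin, contr_vec_mul_vec, he.form_recip hx, smul_sub, Finset.sum_sub_distrib]
  have h1 : ∑ c, ∑ d, riemann g D e c d a b x • eta f c • vec g (recip e d x) =
      ∑ d, (eta f f * riemann g D e f d a b x) • vec g (recip e d x) := by
    rw [Finset.sum_comm]
    refine Finset.sum_congr rfl fun d _ ↦ ?_
    simp_rw [smul_comm _ (eta f _)]
    rw [sum_eta_smul, mul_smul]
  have h2 : ∑ c, ∑ d, riemann g D e c d a b x • eta f d • vec g (recip e c x) =
      -∑ d, (eta f f * riemann g D e f d a b x) • vec g (recip e d x) := by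
    rw [← Finset.sum_neg_distrib]
    refine Finset.sum_congr rfl fun c _ ↦ ?_
    simp_rw [smul_comm _ (eta f _)]
    rw [sum_eta_smul, he.riemann_antisymm_left hD hU hx c f]
    module
  rw [h1, h2]
  module

/-- A curvature bivector determines the corresponding components of the curvature, which are
recovered by contracting twice. -/
lemma riemann_eq_zero_of_curvBivector_eq_zero (he : IsOrthonormalFrameOn g e U)
    (hD : IsLeviCivita g D) (hU : IsOpen U) {x : M} (hx : x ∈ U) {a b : Fin 4}
    (h : curvBivector g D e a b x = 0) (c d : Fin 4) : riemann g D e c d a b x = 0 := by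
  have h1 := congr_arg (contr g (recip e d x)) (he.contr_curvBivector hD hU hx c a b)
  simp only [h, contr, map_zero, map_sum, map_smul, CliffordAlgebra.contractLeft_ι,
    ContinuousLinearMap.coe_coe, he.form_recip hx] at h1
  have h2 : algebraMap ℝ (Cl g x) (eta d d * (eta c c * riemann g D e c d a b x)) = 0 := by
    rw [← sum_eta_mul d fun f ↦ eta c c * riemann g D e c f a b x, map_sum]
    refine (Finset.sum_congr rfl fun f _ ↦ ?_).trans h1.symm
    rw [map_mul, ← Algebra.commutes, ← Algebra.smul_def]
  replace h2 := (FaithfulSMul.algebraMap_injective ℝ (Cl g x)) (h2.trans (map_zero _).symm)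
  linear_combination eta d d * eta c c * h2 - (eta c c * eta c c * riemann g D e c d a b x) *
    eta_mul_eta_self d - riemann g D e c d a b x * eta_mul_eta_self c

lemma contrCurv_eq_ricciVec (he : IsOrthonormalFrameOn g e U) (hD : IsLeviCivita g D)
    (hU : IsOpen U) {x : M} (hx : x ∈ U) (a : Fin 4) :
    contrCurv g D e a x = ricciVec g D e a x := by
  simp only [contrCurv, ricciVec, he.contr_curvBivector hD hU hx, ← Finset.sum_neg_distrib]
  rw [Finset.sum_comm]
  refine Finset.sum_congr rfl fun d _ ↦ ?_
  rw [he.ricci_symm hD hU hx, ricci, Finset.sum_smul]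
  refine Finset.sum_congr rfl fun c _ ↦ ?_
  rw [sum_eta_mul, he.riemann_antisymm_left hD hU hx d c]
  module

/-- `𝓕_{ab}` is the commutator of `R_a - ½ R e_a` with `e_b`. -/
lemma calF_eq_sum (he : IsOrthonormalFrameOn g e U) (hD : IsLeviCivita g D)
    (hU : IsOpen U) {x : M} (hx : x ∈ U) (a b : Fin 4) :
    calF g D e a b x = ∑ c, (eta c c * (ricci g D e a c x - 1 / 2 * eta a c * scalar g D e x)) •
      (vec g (e c x) * vec g (e b x) - vec g (e b x) * vec g (e c x)) := by
  have h : ∑ c, (eta c c * (1 / 2 * eta a c * scalar g D e x)) •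
      (vec g (e c x) * vec g (e b x) - vec g (e b x) * vec g (e c x)) =
      (1 / 2 * scalar g D e x) •
      (vec g (e a x) * vec g (e b x) - vec g (e b x) * vec g (e a x)) := by
    rw [Finset.sum_eq_single a (fun c _ hc ↦ by simp [eta_of_ne hc.symm]) (by simp)]
    congr 1
    linear_combination (1 / 2 * scalar g D e x) * eta_mul_eta_self a
  simp only [calF, he.contrCurv_eq_ricciVec hD hU hx, ricciVec, recip_eq, ← h, mul_sub, sub_smul,
    Finset.sum_sub_distrib, Finset.sum_mul, Finset.mul_sum, map_smul, smul_mul_assoc,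
    mul_smul_comm, smul_smul, smul_sub, mul_comm (eta _ _) (ricci _ _ _ _ _ _)]
  abel

lemma isBivector_calF (he : IsOrthonormalFrameOn g e U) (hD : IsLeviCivita g D)
    (hU : IsOpen U) {x : M} (hx : x ∈ U) (a b : Fin 4) :
    IsBivector g (calF g D e a b x) := by
  rw [he.calF_eq_sum hD hU hx, IsBivector, map_sum]
  refine Submodule.sum_mem _ fun c _ ↦ ?_
  rw [map_smul]
  exact Submodule.smul_mem _ _ (isBivector_commutator g _ _)

lemma isSmooth_calF (he : IsOrthonormalFrameOn g e U) (hD : IsLeviCivita g D)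
    (hU : IsOpen U) (a b : Fin 4) : he.IsSmooth (calF g D e a b) := by
  intro I x hx
  choose k hk using fun c ↦ he.exists_clCoeff_commutator c b I
  have h : ContMDiffAt (𝓡 4) 𝓘(ℝ) ∞ (fun y ↦ ∑ c,
      eta c c * (ricci g D e a c y - 1 / 2 * eta a c * scalar g D e y) * k c) x :=
    ContMDiffAt.sum fun c _ ↦ (contMDiffAt_const.mul
      ((he.contMDiffAt_ricci hD hU hx a c).sub
        (contMDiffAt_const.mul (he.contMDiffAt_scalar hD hU hx)))).mul contMDiffAt_const
  refine (h.congr_of_eventuallyEq (Filter.eventuallyEq_of_mem (hU.mem_nhds hx)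
    fun y hy ↦ ?_)).contMDiffWithinAt
  simp only [clCoeff, hy, dif_pos, he.calF_eq_sum hD hU hy, map_sum, map_smul,
    Finsupp.coe_finsetSum, Finset.sum_apply, Finsupp.smul_apply, smul_eq_mul, hk]

lemma clDeriv_congr (he : IsOrthonormalFrameOn g e U) {A B : Π x : M, Cl g x}
    (h : ∀ y ∈ U, A y = B y) {x : M} (hx : x ∈ U) (v : TangentSpace (𝓡 4) x) :
    he.clDeriv D A hx v = he.clDeriv D B hx v := by
  have hc : he.clCoeff A = he.clCoeff B := by
    ext I y
    by_cases hy : y ∈ U <;> simp [clCoeff, hy, h]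
  simp only [clDeriv, hc, h x hx]

/-- Einstein's equations say that `R_a - ½ R e_a = T_a`; hence `𝓕_{ab} = T_a e_b - e_b T_a`. -/
lemma calF_eq_of_einsteinEqOn (he : IsOrthonormalFrameOn g e U) (hD : IsLeviCivita g D)
    (hU : IsOpen U) {T : TensorField02 M} (hT : EinsteinEqOn g D e T U) {x : M} (hx : x ∈ U)
    (a b : Fin 4) :
    calF g D e a b x = ∑ c, (eta c c * T x (e a x) (e c x)) •
      (vec g (e c x) * vec g (e b x) - vec g (e b x) * vec g (e c x)) := by
  simp only [he.calF_eq_sum hD hU hx, hT x hx]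

lemma calF_eq_zero_of_einsteinEqOn (he : IsOrthonormalFrameOn g e U) (hD : IsLeviCivita g D)
    (hU : IsOpen U) {T : TensorField02 M} (hT : EinsteinEqOn g D e T U) {x : M} (hx : x ∈ U)
    (h0 : T x = 0) (a b : Fin 4) : calF g D e a b x = 0 := by
  rw [he.calF_eq_of_einsteinEqOn hD hU hT hx, h0]
  simp

lemma calFUp_eq_of_einsteinEqOn (he : IsOrthonormalFrameOn g e U) (hD : IsLeviCivita g D)
    (hU : IsOpen U) {T : TensorField02 M} (hT : EinsteinEqOn g D e T U) {x : M} (hx : x ∈ U)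
    (a b : Fin 4) :
    calFUp g D e a b x =
      emVecUp g e T a x * vec g (e b x) - vec g (e b x) * emVecUp g e T a x := by
  simp only [calFUp, emVecUp, sum_eta_smul, he.calF_eq_of_einsteinEqOn hD hU hT hx, recip_eq,
    Finset.sum_mul, Finset.mul_sum, map_smul, smul_mul_assoc,
    mul_smul_comm, smul_smul, smul_sub, Finset.sum_sub_distrib, mul_comm (T _ _ _) (eta _ _)]

end IsOrthonormalFrameOn
end CliffordFields

/-! ### The plane wave metric and its frame -/

namespace PlaneWave

set_option synthInstance.maxHeartbeats 100000

/-- The coordinate functions of `ℝ⁴`. -/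
def coord (i : Fin 4) : E4 →L[ℝ] ℝ := EuclideanSpace.proj i

/-- The tensor product of two covectors. -/
def outer (α β : E4 →L[ℝ] ℝ) : E4 →L[ℝ] E4 →L[ℝ] ℝ := α.smulRight β

lemma coord_apply (i : Fin 4) (v : E4) : coord i v = v i := rfl

lemma outer_apply (α β : E4 →L[ℝ] ℝ) (v w : E4) : outer α β v w = α v * β w := rfl

/-- The covector `k = dx⁰ - dx³`. -/
def covec : E4 →L[ℝ] ℝ := coord 0 - coord 3

/-- The null vector `∂₀ + ∂₃`, obtained from `covec` by raising the index. -/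
def nullVec : E4 := EuclideanSpace.single 0 1 + EuclideanSpace.single 3 1

/-- The Minkowski form on `ℝ⁴`. -/
def minkowski : E4 →L[ℝ] E4 →L[ℝ] ℝ :=
  ∑ i, eta i i • outer (coord i) (coord i)

/-- The profile `H = (x¹)² - (x²)²` of the wave, a harmonic function of the transverse
coordinates. -/
def profile (x : E4) : ℝ := x 1 ^ 2 - x 2 ^ 2

/-- The differential of `profile`, which is linear in the base point. -/
def dProfile : E4 →L[ℝ] E4 →L[ℝ] ℝ :=
  (2 : ℝ) • (outer (coord 1) (coord 1) - outer (coord 2) (coord 2))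

/-- The Minkowski gradient of `profile`. -/
def gradProfile : E4 →L[ℝ] E4 :=
  (2 : ℝ) • ((coord 2).smulRight (EuclideanSpace.single 2 1 : E4)
    - (coord 1).smulRight (EuclideanSpace.single 1 1 : E4))

lemma covec_apply (v : E4) : covec v = v 0 - v 3 := rfl

lemma minkowski_apply (v w : E4) :
    minkowski v w = v 0 * w 0 - v 1 * w 1 - v 2 * w 2 - v 3 * w 3 := by
  simp [minkowski, outer_apply, coord_apply, Fin.sum_univ_four, eta]
  ring

lemma dProfile_apply (x v : E4) : dProfile x v = 2 * (x 1 * v 1 - x 2 * v 2) := by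
  simp [dProfile, outer_apply, coord_apply]

lemma minkowski_comm (v w : E4) : minkowski v w = minkowski w v := by
  simp only [minkowski_apply]; ring

lemma covec_nullVec : covec nullVec = 0 := by simp [covec_apply, nullVec]

lemma covec_gradProfile (x : E4) : covec (gradProfile x) = 0 := by
  simp [covec_apply, gradProfile, coord_apply]

lemma dProfile_nullVec (x : E4) : dProfile x nullVec = 0 := by
  simp [dProfile_apply, nullVec]

lemma minkowski_nullVec (v : E4) : minkowski v nullVec = covec v := by
  simp [minkowski_apply, nullVec, covec_apply]

lemma minkowski_gradProfile (x v : E4) : minkowski v (gradProfile x) = dProfile x v := by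
  simp [minkowski_apply, gradProfile, coord_apply, dProfile_apply]
  ring

lemma hasFDerivAt_profile (x : E4) : HasFDerivAt profile (dProfile x) x := by
  have h (i : Fin 4) : HasFDerivAt (fun y : E4 ↦ y i ^ 2)
      ((2 * x i) • coord i) x := by
    simpa [coord_apply] using ((coord i).hasFDerivAt (x := x)).pow 2
  convert! (h 1).sub (h 2) using 1
  ext v
  simp [dProfile_apply, coord_apply]
  ring

lemma contDiff_profile : ContDiff ℝ ∞ profile := by
  unfold profile
  fun_prop

/-- The plane wave metric `η + H k ⊗ k` at `x`, as a bilinear form on `ℝ⁴`. -/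
def form (x : E4) : E4 →L[ℝ] E4 →L[ℝ] ℝ := minkowski + profile x • outer covec covec

lemma form_apply (x v w : E4) : form x v w = minkowski v w + profile x * (covec v * covec w) := by
  simp [form, outer_apply]

lemma form_comm (x v w : E4) : form x v w = form x w v := by
  rw [form_apply, form_apply, minkowski_comm, mul_comm (covec v)]

/-- The orthonormal frame `e_a = ∂_a - ½ H k_a k^♯` of the plane wave. -/
def frame (a : Fin 4) (x : E4) : E4 :=
  EuclideanSpace.single a 1 - (1 / 2 * profile x * covec (EuclideanSpace.single a 1)) • nullVec

lemma covec_frame (a : Fin 4) (x : E4) :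
    covec (frame a x) = covec (EuclideanSpace.single a 1) := by
  simp [frame, covec_nullVec]

lemma minkowski_single (a b : Fin 4) :
    minkowski (EuclideanSpace.single a 1) (EuclideanSpace.single b 1) = eta a b := by
  rw [minkowski_apply]
  fin_cases a <;> fin_cases b <;> simp [eta]

lemma form_frame_of_covec_eq_zero (a : Fin 4) (x : E4) {w : E4} (hw : covec w = 0) :
    form x (frame a x) w = minkowski (EuclideanSpace.single a 1) w := by
  rw [form_apply, hw, frame, map_sub, map_smul, sub_apply, smul_apply, minkowski_comm nullVec,
    minkowski_nullVec, hw]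
  simp

lemma form_frame (a b : Fin 4) (x : E4) : form x (frame a x) (frame b x) = eta a b := by
  rw [form_apply, covec_frame, covec_frame]
  simp only [frame, map_sub, map_smul, sub_apply, smul_apply, minkowski_single,
    minkowski_nullVec, minkowski_comm nullVec, covec_nullVec, smul_eq_mul]
  ring

lemma linearIndependent_frame (x : E4) : LinearIndependent ℝ (frame · x) := by
  rw [Fintype.linearIndependent_iff]
  intro c hc b
  have h : form x (frame b x) (∑ a, c a • frame a x) = 0 := by rw [hc, map_zero]
  simp only [map_sum, map_smul, form_frame, smul_eq_mul, mul_comm (c _), sum_eta_mul] at h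
  simpa [← mul_assoc, eta_mul_eta_self] using congr_arg (eta b b * ·) h

lemma top_le_span_frame (x : E4) : ⊤ ≤ Submodule.span ℝ (Set.range (frame · x)) :=
  ((linearIndependent_frame x).span_eq_top_of_card_eq_finrank (by simp)).ge

lemma contDiff_frame (a : Fin 4) : ContDiff ℝ ∞ (frame a) :=
  contDiff_const.sub (((contDiff_const.mul contDiff_profile).mul contDiff_const).smul
    contDiff_const)

/-- The Christoffel map of the plane wave metric:
`Γ(Z, X) = ½ ((dH(X) k(Z) + dH(Z) k(X)) k^♯ - k(X) k(Z) (dH)^♯)`. -/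
def gamma (x : E4) : E4 →L[ℝ] E4 →L[ℝ] E4 :=
  (1 / 2 : ℝ) • (covec.smulRight ((dProfile x).smulRight nullVec)
    + (dProfile x).smulRight (covec.smulRight nullVec))
    + (-1 / 2 : ℝ) • covec.smulRight (covec.smulRight (gradProfile x))

lemma gamma_apply (x Z X : E4) : gamma x Z X = (1 / 2 : ℝ) •
    ((dProfile x X * covec Z + dProfile x Z * covec X) • nullVec
      - (covec X * covec Z) • gradProfile x) := by
  simp only [gamma, add_apply, smul_apply, ContinuousLinearMap.smulRight_apply]
  module

lemma gamma_comm (x Z X : E4) : gamma x Z X = gamma x X Z := by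
  rw [gamma_apply, gamma_apply, add_comm, mul_comm (covec X)]

/-- The right side is the derivative of the plane wave form along `v`, evaluated at `X` and `Y`. -/
lemma form_gamma_add (x X Y v : E4) :
    form x (gamma x X v) Y + form x X (gamma x Y v) = dProfile x v * (covec X * covec Y) := by
  rw [form_comm x (gamma x X v)]
  simp only [form_apply, gamma_apply, map_smul, map_sub, minkowski_nullVec, minkowski_gradProfile,
    covec_nullVec, covec_gradProfile, smul_eq_mul]
  ring

/-- The frame at `x` as a basis. -/
def frameBasis (x : E4) : Module.Basis (Fin 4) ℝ E4 :=
  Module.Basis.mk (linearIndependent_frame x) (top_le_span_frame x)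

lemma frameBasis_apply (x : E4) (a : Fin 4) : frameBasis x a = frame a x := by
  simp [frameBasis]

lemma contDiff_form : ContDiff ℝ ∞ form := by
  simp only [contDiff_clm_apply_iff, form_apply]
  intro v w
  exact contDiff_const.add (contDiff_profile.mul contDiff_const)

/-- The plane wave metric on `ℝ⁴`. -/
def metric : LorentzMetric E4 where
  form x := form x
  symm x v w := form_comm x v w
  signature x := ⟨frameBasis x, fun i j ↦ by
    have h := form_frame i j x
    rw [← frameBasis_apply, ← frameBasis_apply] at h
    exact h⟩
  smooth := by
    intro x
    -- the trivializations involved are the identity, so that the section is the map `form`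
    refine (contMDiffAt_section ..).2 ?_
    convert! contDiff_form.contMDiff.contMDiffAt
    ext v w
    rw [hom_trivializationAt_apply]
    simp [ContinuousLinearMap.inCoordinates]
    rw [Trivialization.linearMapAt_apply, if_pos (by simp; trivial), hom_trivializationAt_apply]
    simp [ContinuousLinearMap.inCoordinates]
    rfl

lemma mdifferentiableAt_iff {X : Π x : E4, TangentSpace (𝓡 4) x} {x : E4} :
    DiffFieldAt X x ↔ DifferentiableAt ℝ (fun y : E4 ↦ (X y : E4)) x := by
  refine (mdifferentiableAt_section ..).trans ?_
  refine Iff.trans ?_ mdifferentiableAt_iff_differentiableAt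
  simp

lemma mvfderiv_eq_fderiv (f : E4 → ℝ) (x : E4) : mvfderiv (𝓡 4) f x = fderiv ℝ f x := by
  ext v
  simp only [mvfderiv, mfderiv_eq_fderiv]
  rfl

/-! ### The Levi-Civita connection of the plane wave -/

/-- The covariant derivative `D_X Y = ∂_X Y + Γ(Y, X)` of vector fields regarded as maps
`ℝ⁴ → ℝ⁴`. -/
def cov (Y : E4 → E4) (x : E4) : E4 →L[ℝ] E4 := fderiv ℝ Y x + gamma x (Y x)

lemma cov_apply (Y : E4 → E4) (x v : E4) : cov Y x v = fderiv ℝ Y x v + gamma x (Y x) v := rfl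

lemma cov_add {Y Y' : E4 → E4} {x : E4} (hY : DifferentiableAt ℝ Y x)
    (hY' : DifferentiableAt ℝ Y' x) : cov (Y + Y') x = cov Y x + cov Y' x := by
  simp only [cov, fderiv_add hY hY', Pi.add_apply, map_add]
  abel

lemma cov_smul {Y : E4 → E4} {f : E4 → ℝ} {x : E4} (hf : DifferentiableAt ℝ f x)
    (hY : DifferentiableAt ℝ Y x) :
    cov (f • Y) x = f x • cov Y x + (fderiv ℝ f x).smulRight (Y x) := by
  simp only [cov, fderiv_smul hf hY, Pi.smul_apply', map_smul, smul_add]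
  abel

/-- `cov` is torsion free. -/
lemma cov_sub_cov (X Y : E4 → E4) (x : E4) :
    cov Y x (X x) - cov X x (Y x) = VectorField.lieBracket ℝ X Y x := by
  rw [cov_apply, cov_apply, gamma_comm x (Y x), VectorField.lieBracket]
  abel

/-- `cov` is compatible with the plane wave metric. -/
lemma fderiv_form {X Y : E4 → E4} {x : E4} (hX : DifferentiableAt ℝ X x)
    (hY : DifferentiableAt ℝ Y x) (v : E4) :
    fderiv ℝ (fun y ↦ form y (X y) (Y y)) x v =
      form x (cov X x v) (Y x) + form x (X x) (cov Y x v) := by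
  have h := (minkowski.hasFDerivAt_of_bilinear hX.hasFDerivAt hY.hasFDerivAt).add
    ((hasFDerivAt_profile x).mul ((covec.hasFDerivAt.comp x hX.hasFDerivAt).mul
      (covec.hasFDerivAt.comp x hY.hasFDerivAt)))
  have hfun : (fun y ↦ form y (X y) (Y y)) = (fun y ↦ minkowski (X y) (Y y)) +
      profile * ((covec ∘ X) * (covec ∘ Y)) :=
    funext fun y ↦ form_apply y (X y) (Y y)
  have hΓ := form_gamma_add x (X x) (Y x) v
  rw [hfun, h.fderiv]
  simp only [cov_apply, map_add, add_apply]
  simp only [form_apply x (fderiv _ _ _ _), form_apply x _ (fderiv _ _ _ _), add_apply,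
    smul_apply, ContinuousLinearMap.precompR_apply, ContinuousLinearMap.precompL_apply,
    ContinuousLinearMap.compL_apply, ContinuousLinearMap.comp_apply,
    Function.comp_apply, Pi.mul_apply, smul_eq_mul]
  linear_combination -hΓ

/-- The Levi-Civita connection of the plane wave. -/
def connection : LinConnection E4 where
  toFun := cov
  isCovariantDerivativeOnUniv :=
    { add := fun hY hY' _ ↦ cov_add (mdifferentiableAt_iff.1 hY) (mdifferentiableAt_iff.1 hY')
      leibniz := by
        intro Y f x hY hf _
        rw [mvfderiv_eq_fderiv]
        exact cov_smul (mdifferentiableAt_iff_differentiableAt.1 hf) (mdifferentiableAt_iff.1 hY) }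

lemma mlieBracket_eq (X Y : Π x : E4, TangentSpace (𝓡 4) x) (x : E4) :
    VectorField.mlieBracket (𝓡 4) X Y x =
      VectorField.lieBracket ℝ (fun y ↦ (X y : E4)) (fun y ↦ (Y y : E4)) x := by
  rw [← VectorField.mlieBracketWithin_univ, VectorField.mlieBracketWithin_eq_lieBracketWithin]
  exact congrFun (VectorField.lieBracketWithin_univ (𝕜 := ℝ) (V := X) (W := Y)) x

lemma isLeviCivita : IsLeviCivita metric connection where
  torsion_eq_zero := by
    exact connection.torsion_eq_zero_iff.2 fun {X Y x} _ _ ↦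
      (cov_sub_cov X Y x).trans (mlieBracket_eq X Y x).symm
  metric := by
    intro X Y x hX hY v
    rw [mvfderiv_eq_fderiv]
    exact fderiv_form (mdifferentiableAt_iff.1 hX) (mdifferentiableAt_iff.1 hY) v

/-! ### The curvature of the plane wave -/

/-- The covariant derivative of `frame b` along `v` is `½ k(v) • frameDeriv b x`. -/
def frameDeriv (b : Fin 4) : E4 →L[ℝ] E4 :=
  (dProfile (EuclideanSpace.single b 1)).smulRight nullVec
    - covec (EuclideanSpace.single b 1) • gradProfile

lemma dProfile_comm (x y : E4) : dProfile x y = dProfile y x := by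
  simp only [dProfile_apply]
  ring

lemma frameDeriv_apply (b : Fin 4) (x : E4) :
    frameDeriv b x = dProfile (EuclideanSpace.single b 1) x • nullVec
      - covec (EuclideanSpace.single b 1) • gradProfile x := by
  simp [frameDeriv]

lemma covec_frameDeriv (b : Fin 4) (x : E4) : covec (frameDeriv b x) = 0 := by
  simp [frameDeriv_apply, covec_nullVec, covec_gradProfile]

lemma frameDeriv_frame (b c : Fin 4) (x : E4) :
    frameDeriv b (frame c x) = frameDeriv b (EuclideanSpace.single c 1) := by
  have h : frameDeriv b nullVec = 0 := by
    rw [frameDeriv_apply, dProfile_nullVec]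
    simp [gradProfile, nullVec, coord_apply]
  rw [frame, map_sub, map_smul, h]
  simp

lemma fderiv_frame_apply (b : Fin 4) (x v : E4) :
    fderiv ℝ (frame b) x v =
      -(1 / 2 * dProfile x v * covec (EuclideanSpace.single b 1)) • nullVec := by
  have h := ((((hasFDerivAt_profile x).const_mul (1 / 2)).mul_const
    (covec (EuclideanSpace.single b 1))).smul_const nullVec).const_sub (EuclideanSpace.single b 1)
  have h' := congr_arg (fun L : E4 →L[ℝ] E4 ↦ L v) h.fderiv
  refine h'.trans ?_
  simp
  ring_nf

lemma cov_frame (b : Fin 4) (x v : E4) :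
    cov (frame b) x v = (1 / 2 * covec v) • frameDeriv b x := by
  rw [cov_apply, fderiv_frame_apply, gamma_apply, covec_frame, frameDeriv_apply, frame, map_sub,
    map_smul, dProfile_nullVec, dProfile_comm _ x]
  simp only [smul_zero, sub_zero]
  module

lemma cov_cov_frame (b c d : Fin 4) (x : E4) :
    cov (fun y ↦ cov (frame b) y (frame d y)) x (frame c x) =
      (1 / 2 * covec (EuclideanSpace.single d 1)) • frameDeriv b (EuclideanSpace.single c 1)
      + (1 / 4 * covec (EuclideanSpace.single d 1) * covec (EuclideanSpace.single c 1)
        * dProfile x (frameDeriv b x)) • nullVec := by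
  have hfun : (fun y ↦ cov (frame b) y (frame d y)) =
      ⇑((1 / 2 * covec (EuclideanSpace.single d 1)) • frameDeriv b) := by
    ext1 y
    rw [cov_frame, covec_frame, smul_apply]
  rw [hfun, cov_apply, ContinuousLinearMap.fderiv, smul_apply, smul_apply, frameDeriv_frame,
    map_smul, smul_apply, gamma_apply, covec_frameDeriv, covec_frame]
  module

lemma covec_lieBracket_frame (c d : Fin 4) (x : E4) :
    covec (VectorField.lieBracket ℝ (frame c) (frame d) x) = 0 := by
  simp only [VectorField.lieBracket, fderiv_frame_apply, map_sub, map_smul, covec_nullVec,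
    smul_zero, sub_zero]

lemma curvature_frame (b c d : Fin 4) (x : E4) :
    curvature connection (frame c) (frame d) (frame b) x =
      ((1 / 2 * covec (EuclideanSpace.single d 1)) • frameDeriv b (EuclideanSpace.single c 1)
        - (1 / 2 * covec (EuclideanSpace.single c 1)) • frameDeriv b (EuclideanSpace.single d 1) :
          E4) := by
  refine (congrArg (fun w : E4 ↦ cov (fun y ↦ cov (frame b) y (frame d y)) x (frame c x)
    - cov (fun y ↦ cov (frame b) y (frame c y)) x (frame d x) - cov (frame b) x w)
    (mlieBracket_eq (frame c) (frame d) x)).trans ?_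
  change cov (fun y ↦ cov (frame b) y (frame d y)) x (frame c x)
    - cov (fun y ↦ cov (frame b) y (frame c y)) x (frame d x)
    - cov (frame b) x (VectorField.lieBracket ℝ (frame c) (frame d) x) = _
  rw [cov_cov_frame, cov_cov_frame, cov_frame, covec_lieBracket_frame]
  module

/-- The curvature of the plane wave has constant components in the frame:
`R_{abcd} = ½ (k_d (k_a H_{bc} - k_b H_{ac}) - k_c (k_a H_{bd} - k_b H_{ad}))`. -/
lemma riemann_frame (a b c d : Fin 4) (x : E4) :
    riemann metric connection frame a b c d x =
      1 / 2 * (covec (EuclideanSpace.single d 1) *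
          (covec (EuclideanSpace.single a 1) *
              dProfile (EuclideanSpace.single b 1) (EuclideanSpace.single c 1) -
            covec (EuclideanSpace.single b 1) *
              dProfile (EuclideanSpace.single a 1) (EuclideanSpace.single c 1)) -
        covec (EuclideanSpace.single c 1) *
          (covec (EuclideanSpace.single a 1) *
              dProfile (EuclideanSpace.single b 1) (EuclideanSpace.single d 1) -
            covec (EuclideanSpace.single b 1) *
              dProfile (EuclideanSpace.single a 1) (EuclideanSpace.single d 1))) := by
  have h (c : Fin 4) : form x (frame a x) (frameDeriv b (EuclideanSpace.single c 1)) =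
      covec (EuclideanSpace.single a 1) *
        dProfile (EuclideanSpace.single b 1) (EuclideanSpace.single c 1) -
      covec (EuclideanSpace.single b 1) *
        dProfile (EuclideanSpace.single a 1) (EuclideanSpace.single c 1) := by
    rw [form_frame_of_covec_eq_zero a x (covec_frameDeriv b _), frameDeriv_apply, map_sub,
      map_smul, map_smul, minkowski_nullVec, minkowski_gradProfile,
      dProfile_comm (EuclideanSpace.single c 1), smul_eq_mul, smul_eq_mul]
    ring
  refine (congrArg (form x (frame a x)) (curvature_frame b c d x)).trans ?_
  rw [map_sub, map_smul, map_smul, h, h, smul_eq_mul, smul_eq_mul]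
  ring

/-- The Ricci tensor vanishes because `k` is null, `H` does not vary along `k^♯` and `H` is
harmonic. -/
lemma ricci_frame (a b : Fin 4) (x : E4) : ricci metric connection frame a b x = 0 := by
  simp only [ricci, riemann_frame, sum_eta_mul]
  rw [Fin.sum_univ_four]
  fin_cases a <;> fin_cases b <;> simp [eta, covec_apply, dProfile_apply]

lemma isOrthonormalFrameOn : IsOrthonormalFrameOn metric frame Set.univ where
  isLocalFrameOn :=
    { linearIndependent := fun {x} _ ↦ linearIndependent_frame x
      generating := fun {x} _ ↦ top_le_span_frame x
      contMDiffOn := fun a ↦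
        (contMDiff_vectorSpace_iff_contDiff.2 (contDiff_frame a)).contMDiffOn }
  orthonormal := fun {x} _ a b ↦ form_frame a b x

lemma scalar_frame (x : E4) : scalar metric connection frame x = 0 := by
  simp [scalar, ricci_frame]

lemma einsteinEqOn : EinsteinEqOn metric connection frame (fun _ ↦ 0) Set.univ := by
  intro x _ a b
  rw [ricci_frame, scalar_frame, mul_zero, sub_zero]
  rfl

lemma riemann_frame_zero_one (x : E4) : riemann metric connection frame 0 1 0 1 x = -1 := by
  rw [riemann_frame]
  simp [covec_apply, dProfile_apply]

lemma curvBivector_ne_zero : curvBivector metric connection frame 0 1 0 ≠ 0 := by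
  intro h
  have h1 := isOrthonormalFrameOn.riemann_eq_zero_of_curvBivector_eq_zero isLeviCivita isOpen_univ
    (Set.mem_univ (0 : E4)) h 0 1
  rw [riemann_frame_zero_one] at h1
  norm_num at h1

end PlaneWave

end MaxwellEinstein

end

/-! ### The Maxwell-like form of Einstein's equations -/

theorem mainTheorem11 :
    (∀ (M : Type*) [TopologicalSpace M] [ChartedSpace MaxwellEinstein.E4 M]
      [IsManifold (𝓡 4) ∞ M]
      (g : MaxwellEinstein.LorentzMetric M) (D : MaxwellEinstein.LinConnection M)
      (_hD : MaxwellEinstein.IsLeviCivita g D)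
      (U : Set M) (_hU : IsOpen U)
      (e : Fin 4 → Π x : M, TangentSpace (𝓡 4) x)
      (he : MaxwellEinstein.IsOrthonormalFrameOn g e U)
      (T : MaxwellEinstein.TensorField02 M)
      (_hT : MaxwellEinstein.EinsteinEqOn g D e T U),
      -- the `𝓕_{ab}` are smooth bivector fields
      (∀ a b, he.IsSmooth (MaxwellEinstein.calF g D e a b)) ∧
      (∀ a b, ∀ x ∈ U, MaxwellEinstein.IsBivector g (MaxwellEinstein.calF g D e a b x)) ∧
      -- `-e^c ⌟ 𝐑_{ac}` is the Ricci vector `R_a`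
      (∀ a, ∀ x ∈ U,
        MaxwellEinstein.contrCurv g D e a x = MaxwellEinstein.ricciVec g D e a x) ∧
      -- `D_{e_a} 𝓕^a_b = 𝓙_b`
      (∀ b, ∀ x, ∀ hx : x ∈ U,
        ∑ a, he.clDeriv D (MaxwellEinstein.calFUp g D e a b) hx (e a x) =
          MaxwellEinstein.calJ he D T b hx) ∧
      -- `𝓕_{ab} = 0` in vacuum
      (∀ x ∈ U, T x = 0 → ∀ a b, MaxwellEinstein.calF g D e a b x = 0)) ∧
    -- there is a vacuum spacetime with a curvature bivector that does not vanish
    (∃ (g : MaxwellEinstein.LorentzMetric MaxwellEinstein.E4)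
      (D : MaxwellEinstein.LinConnection MaxwellEinstein.E4)
      (e : Fin 4 → Π x : MaxwellEinstein.E4, TangentSpace (𝓡 4) x),
      MaxwellEinstein.IsLeviCivita g D ∧
      MaxwellEinstein.IsOrthonormalFrameOn g e Set.univ ∧
      MaxwellEinstein.EinsteinEqOn g D e (fun _ ↦ 0) Set.univ ∧
      (∀ a b x, MaxwellEinstein.calF g D e a b x = 0) ∧
      ∃ a b x, MaxwellEinstein.curvBivector g D e a b x ≠ 0) := by
  refine ⟨?_, ?_⟩
  · intro M _ _ _ g D hD U hU e he T hT
    refine ⟨he.isSmooth_calF hD hU, fun a b x hx ↦ he.isBivector_calF hD hU hx a b,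
      fun a x hx ↦ he.contrCurv_eq_ricciVec hD hU hx a, fun b x hx ↦ ?_,
      fun x hx h0 a b ↦ he.calF_eq_zero_of_einsteinEqOn hD hU hT hx h0 a b⟩
    -- both sides are divergences of fields that agree on `U`
    exact Finset.sum_congr rfl fun a _ ↦ he.clDeriv_congr
      (fun y hy ↦ he.calFUp_eq_of_einsteinEqOn hD hU hT hy a b) hx (e a x)
  · open MaxwellEinstein.PlaneWave in
    refine ⟨metric, connection, frame, isLeviCivita, isOrthonormalFrameOn, einsteinEqOn,
      fun a b x ↦ ?_, 0, 1, 0, curvBivector_ne_zero⟩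
    exact isOrthonormalFrameOn.calF_eq_zero_of_einsteinEqOn isLeviCivita isOpen_univ einsteinEqOn
      (Set.mem_univ x) rfl a b
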